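/- Let $m\ge 1$, let $n_1,\ldots,n_m$ be positive integers, put $n_{m+1}=0$, and let $r$ be a nonnegative integer. Then $$ 2\,(n_1-1)!\,\prod_{i=1}^{m}\frac{(n_i+n_{i+1})!}{(2n_i)!}\;\sum_{k=1}^{n_1}k^{2r+1}\prod_{i=1}^{m}\binom{2n_i}{n_i+k} $$ is an integer. -/

import Mathlib

/-! Dividing each binomial by `(2n)!` gives weights w(n,k) = 1/((n-k)!(n+k)!) for k ≤ n. By
Vandermonde, a product of two adjacent weights is, after normalisation by factorials, an integer
combination of single weights (`centralWeight_mul`). Hence the first two entries of the chain merge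
into one entry s, with integer coefficients (`chainMoment_succ`). Induction on length leaves the
chain (n, 0), whose odd moments are integers by a recursion in r (`centralMoment_isInt`). -/

/-- The central binomial coefficient `(2n).choose (n+k)` divided by `(2n)!`. -/
def centralWeight (n k : ℕ) : ℚ := ((2 * n).choose (n + k) : ℚ) / ((2 * n).factorial : ℚ)

theorem centralWeight_eq_zero {n k : ℕ} (h : n < k) : centralWeight n k = 0 := by
  rw [centralWeight, Nat.choose_eq_zero_of_lt (by omega)]
  simp

theorem centralWeight_add (d k : ℕ) :
    centralWeight (d + k) k = 1 / ((d.factorial : ℚ) * ((d + 2 * k).factorial : ℚ)) := by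
  have h := Nat.add_choose_mul_factorial_mul_factorial d (d + 2 * k)
  have e : d + (d + 2 * k) = 2 * (d + k) := by ring
  rw [e] at h
  have hq : ((2 * (d + k)).choose (d + 2 * k) : ℚ) * d.factorial * (d + 2 * k).factorial =
      (2 * (d + k)).factorial := by exact_mod_cast h
  have h1 : (d.factorial : ℚ) ≠ 0 := by positivity
  have h2 : ((d + 2 * k).factorial : ℚ) ≠ 0 := by positivity
  have h3 : ((2 * (d + k)).factorial : ℚ) ≠ 0 := by positivity
  rw [centralWeight, show d + k + k = d + 2 * k by ring]
  field_simp
  linarith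

theorem cast_choose_add (a b : ℕ) :
    ((a + b).choose a : ℚ) = (a + b).factorial / (a.factorial * b.factorial) := by
  rw [Nat.cast_add_choose]

/-- Vandermonde's identity, indexed by the part left out of the first block. -/
theorem vandermonde_sum (d b k : ℕ) :
    (d + k + (b + k)).choose (d + 2 * k) =
      ∑ j ∈ Finset.range (d + 1), d.choose j * (b + 2 * k).choose (j + 2 * k) := by
  have e : d + k + (b + k) = d + (b + 2 * k) := by ring
  rw [e, Nat.add_choose_eq, Finset.Nat.sum_antidiagonal_eq_sum_range_succ
    (fun i j => d.choose i * (b + 2 * k).choose j)]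
  rw [← Finset.sum_range_reflect (fun j => d.choose j * (b + 2 * k).choose (j + 2 * k))]
  symm
  apply Finset.sum_subset_zero_on_sdiff
  · intro x hx
    simp only [Finset.mem_range] at *
    omega
  · intro x hx
    simp only [Finset.mem_sdiff, Finset.mem_range] at hx
    rw [Nat.choose_eq_zero_of_lt (by omega), zero_mul]
  · intro x hx
    simp only [Finset.mem_range] at hx
    rw [show d + 1 - 1 - x = d - x by omega, Nat.choose_symm (by omega),
      show d - x + 2 * k = d + 2 * k - x by omega]

/-- Vandermonde expands `(a + b)!`, with s = j + k. The factorials on each side are those that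
normalise the chains a, b, c, … and s, c, …, so the leftover coefficients are integers. -/
theorem centralWeight_mul (a b c k : ℕ) (hk : 1 ≤ k) :
    ((a - 1).factorial : ℚ) * (a + b).factorial * (b + c).factorial *
        (centralWeight a k * centralWeight b k) =
      ∑ s ∈ Finset.Icc 1 a, ((a - 1).choose (s - 1) : ℚ) * ((b + c).choose (c + s) : ℚ) *
        ((s - 1).factorial * (s + c).factorial * centralWeight s k) := by
  rcases lt_or_ge a k with hak | hak
  · rw [centralWeight_eq_zero hak, Finset.sum_eq_zero]
    · simp
    · intro s hs
      rw [centralWeight_eq_zero (lt_of_le_of_lt (Finset.mem_Icc.1 hs).2 hak), mul_zero, mul_zero]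
  rcases lt_or_ge b k with hbk | hbk
  · rw [centralWeight_eq_zero hbk, Finset.sum_eq_zero]
    · simp
    · intro s hs
      rcases lt_or_ge s k with h | h
      · rw [centralWeight_eq_zero h, mul_zero, mul_zero]
      · rw [Nat.choose_eq_zero_of_lt (show b + c < c + s by omega)]
        simp
  obtain ⟨d, rfl⟩ := Nat.exists_eq_add_of_le' hak
  obtain ⟨e, rfl⟩ := Nat.exists_eq_add_of_le' hbk
  have hsub : ∑ s ∈ Finset.Icc 1 (d + k), ((d + k - 1).choose (s - 1) : ℚ) *
        ((e + k + c).choose (c + s) : ℚ) *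
        ((s - 1).factorial * (s + c).factorial * centralWeight s k) =
      ∑ j ∈ Finset.range (d + 1), ((d + k - 1).choose (j + k - 1) : ℚ) *
        ((e + k + c).choose (c + (j + k)) : ℚ) *
        ((j + k - 1).factorial * (j + k + c).factorial * centralWeight (j + k) k) := by
    symm
    apply Finset.sum_of_injOn (fun j => j + k)
    · exact fun x _ y _ h => by simpa using h
    · intro x hx
      simp only [Finset.coe_range, Set.mem_Iio, Finset.coe_Icc, Set.mem_Icc] at *
      omega
    · intro s hs hs'
      rw [centralWeight_eq_zero, mul_zero, mul_zero]
      by_contra hsk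
      apply hs'
      refine ⟨s - k, ?_, ?_⟩
      · simp only [Finset.coe_range, Set.mem_Iio, Finset.mem_Icc] at *
        omega
      · simp only
        omega
    · intro x _
      rfl
  rw [hsub, centralWeight_add, centralWeight_add]
  have hV : ((d + k + (e + k)).factorial : ℚ) =
      (d + 2 * k).factorial * e.factorial *
        ∑ j ∈ Finset.range (d + 1), (d.choose j : ℚ) * (e + 2 * k).choose (j + 2 * k) := by
    have h := vandermonde_sum d e k
    have h2 := cast_choose_add (d + 2 * k) e
    rw [show d + 2 * k + e = d + k + (e + k) by ring, h] at h2
    push_cast at h2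
    rw [h2]
    field_simp
  rw [hV]
  simp only [Finset.mul_sum, Finset.sum_mul]
  apply Finset.sum_congr rfl
  intro j hj
  obtain ⟨i, rfl⟩ := Nat.exists_eq_add_of_le (Nat.lt_succ_iff.1 (Finset.mem_range.1 hj))
  rcases lt_or_ge e j with hej | hej
  · rw [Nat.choose_eq_zero_of_lt (show e + 2 * k < j + 2 * k by omega),
      Nat.choose_eq_zero_of_lt (show e + k + c < c + (j + k) by omega)]
    simp
  obtain ⟨t, rfl⟩ := Nat.exists_eq_add_of_le hej
  -- Positivity of k removes the truncated subtractions.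
  obtain ⟨l, rfl⟩ := Nat.exists_eq_add_of_le hk
  have e1 := cast_choose_add j i
  have e2 := cast_choose_add (j + 2 * (1 + l)) t
  have e3 := cast_choose_add (j + l) i
  have e4 := cast_choose_add (c + (j + (1 + l))) t
  rw [show j + 2 * (1 + l) + t = j + t + 2 * (1 + l) by ring] at e2
  rw [show j + l + i = j + i + l by ring] at e3
  rw [show c + (j + (1 + l)) + t = j + t + (1 + l) + c by ring,
    show c + (j + (1 + l)) = j + (1 + l) + c by ring] at e4
  rw [centralWeight_add, show j + i + (1 + l) - 1 = j + i + l by omega,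
    show j + (1 + l) - 1 = j + l by omega, show c + (j + (1 + l)) = j + (1 + l) + c by ring,
    e1, e2, e3, e4]
  field_simp

/-- The odd moment of the weights `centralWeight n k`, normalised to be an integer. -/
def centralMoment (r n : ℕ) : ℚ :=
  2 * (n - 1).factorial * n.factorial *
    ∑ k ∈ Finset.Icc 1 n, (k : ℚ) ^ (2 * r + 1) * centralWeight n k

/-- Telescoping from the top index down, since 2k = (n+1+k) - (n+1-k). -/
theorem sum_mul_centralWeight (n j : ℕ) (hj : j ≤ n) :
    ∑ k ∈ Finset.Icc (n + 1 - j) (n + 1), 2 * (k : ℚ) * centralWeight (n + 1) k =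
      1 / ((2 * n + 1 - j).factorial * j.factorial) := by
  induction j with
  | zero =>
    have h := centralWeight_add 0 (n + 1)
    rw [zero_add, zero_add] at h
    simp only [Nat.sub_zero, Finset.Icc_self, Finset.sum_singleton, h]
    rw [show 2 * (n + 1) = 2 * n + 1 + 1 by ring, Nat.factorial_succ (2 * n + 1)]
    push_cast
    field_simp
    ring
  | succ j ih =>
    obtain ⟨l, rfl⟩ := Nat.exists_eq_add_of_le hj
    have hI : Finset.Icc (j + 1 + l + 1 - (j + 1)) (j + 1 + l + 1) =
        insert (l + 1) (Finset.Icc (j + 1 + l + 1 - j) (j + 1 + l + 1)) := by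
      ext x
      simp only [Finset.mem_Icc, Finset.mem_insert]
      omega
    have h := centralWeight_add (j + 1) (l + 1)
    rw [hI, Finset.sum_insert (by simp only [Finset.mem_Icc]; omega), ih (by omega),
      show j + 1 + l + 1 = j + 1 + (l + 1) by ring, h,
      show 2 * (j + 1 + l) + 1 - j = j + 2 * l + 2 + 1 by omega,
      show 2 * (j + 1 + l) + 1 - (j + 1) = j + 2 * l + 2 by omega,
      show j + 1 + 2 * (l + 1) = j + 2 * l + 2 + 1 by ring,
      Nat.factorial_succ (j + 2 * l + 2), Nat.factorial_succ j]
    push_cast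
    field_simp
    ring

theorem centralMoment_zero (n : ℕ) : centralMoment 0 (n + 1) = 1 := by
  have h := sum_mul_centralWeight n n le_rfl
  rw [show n + 1 - n = 1 by omega, show 2 * n + 1 - n = n + 1 by omega] at h
  have h2 : centralMoment 0 (n + 1) = n.factorial * (n + 1).factorial *
      ∑ k ∈ Finset.Icc 1 (n + 1), 2 * (k : ℚ) * centralWeight (n + 1) k := by
    simp only [centralMoment, Finset.mul_sum, Nat.add_sub_cancel]
    exact Finset.sum_congr rfl fun k _ => by ring
  rw [h2, h]
  field_simp

/-- Write k² = (n+1)² - (n+1-k)(n+1+k); the last product cancels into the factorials. -/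
theorem sq_mul_centralWeight (n k : ℕ) (hk : k ≤ n + 1) :
    (k : ℚ) ^ 2 * centralWeight (n + 1) k =
      ((n : ℚ) + 1) ^ 2 * centralWeight (n + 1) k - centralWeight n k := by
  rcases Nat.lt_or_ge n k with h | h
  · rw [centralWeight_eq_zero h]
    obtain rfl : k = n + 1 := by omega
    push_cast
    ring
  · obtain ⟨d, rfl⟩ := Nat.exists_eq_add_of_le' h
    have h1 := centralWeight_add (d + 1) k
    rw [show d + 1 + k = d + k + 1 by ring, show d + 1 + 2 * k = d + 2 * k + 1 by ring] at h1
    rw [h1, centralWeight_add, Nat.factorial_succ, Nat.factorial_succ]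
    push_cast
    field_simp
    ring

theorem centralMoment_succ_one (r : ℕ) : centralMoment r 1 = 1 := by
  have h := centralWeight_add 0 1
  norm_num at h
  norm_num [centralMoment, h]

theorem centralMoment_succ (r n : ℕ) :
    centralMoment (r + 1) (n + 2) = ((n : ℚ) + 2) ^ 2 * centralMoment r (n + 2) -
      (n + 1) * (n + 2) * centralMoment r (n + 1) := by
  have h : ∑ k ∈ Finset.Icc 1 (n + 2), (k : ℚ) ^ (2 * (r + 1) + 1) * centralWeight (n + 2) k =
      ((n : ℚ) + 2) ^ 2 *
        ∑ k ∈ Finset.Icc 1 (n + 2), (k : ℚ) ^ (2 * r + 1) * centralWeight (n + 2) k -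
      ∑ k ∈ Finset.Icc 1 (n + 1), (k : ℚ) ^ (2 * r + 1) * centralWeight (n + 1) k := by
    have h0 : ∑ k ∈ Finset.Icc 1 (n + 1), (k : ℚ) ^ (2 * r + 1) * centralWeight (n + 1) k =
        ∑ k ∈ Finset.Icc 1 (n + 2), (k : ℚ) ^ (2 * r + 1) * centralWeight (n + 1) k := by
      rw [Finset.sum_Icc_succ_top (b := n + 1) (by omega),
        centralWeight_eq_zero (show n + 1 < n + 1 + 1 by omega)]
      simp
    rw [h0, Finset.mul_sum, ← Finset.sum_sub_distrib]
    apply Finset.sum_congr rfl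
    intro k hk
    have h1 := sq_mul_centralWeight (n + 1) k (Finset.mem_Icc.1 hk).2
    push_cast at h1
    rw [show 2 * (r + 1) + 1 = 2 * r + 1 + 2 by ring, pow_add, mul_assoc, h1]
    ring
  rw [centralMoment, h, centralMoment, centralMoment, show n + 2 - 1 = n + 1 by omega,
    Nat.add_sub_cancel, Nat.factorial_succ (n + 1), Nat.factorial_succ n]
  push_cast
  ring

theorem centralMoment_isInt (r n : ℕ) : ∃ z : ℤ, centralMoment r (n + 1) = z := by
  induction r generalizing n with
  | zero => exact ⟨1, by rw [centralMoment_zero]; simp⟩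
  | succ r ih =>
    rcases n with _ | n
    · exact ⟨1, by rw [zero_add, centralMoment_succ_one]; simp⟩
    · obtain ⟨x, hx⟩ := ih (n + 1)
      obtain ⟨y, hy⟩ := ih n
      refine ⟨((n : ℤ) + 2) ^ 2 * x - (n + 1) * (n + 2) * y, ?_⟩
      rw [centralMoment_succ, hx, hy]
      push_cast
      ring

/-- The normalised odd moment of a product of weights along the chain `n 0, …, n m`. -/
def chainMoment (r m : ℕ) (n : ℕ → ℕ) : ℚ :=
  2 * ((n 0 - 1).factorial : ℚ) *
    (∏ i ∈ Finset.range (m + 1), ((n i + n (i + 1)).factorial : ℚ)) *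
    ∑ k ∈ Finset.Icc 1 (n 0),
      (k : ℚ) ^ (2 * r + 1) * ∏ i ∈ Finset.range (m + 1), centralWeight (n i) k

/-- Replace the first two terms of a sequence by a single one. -/
def mergeHead (s : ℕ) (n : ℕ → ℕ) : ℕ → ℕ
  | 0 => s
  | i + 1 => n (i + 2)

theorem chainMoment_succ (r m : ℕ) (n : ℕ → ℕ) :
    chainMoment r (m + 1) n = ∑ s ∈ Finset.Icc 1 (n 0),
      ((n 0 - 1).choose (s - 1) : ℚ) * ((n 1 + n 2).choose (n 2 + s) : ℚ) *
        chainMoment r m (mergeHead s n) := by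
  set P : ℚ := ∏ i ∈ Finset.range m, ((n (i + 2) + n (i + 3)).factorial : ℚ) with hP
  set Q : ℕ → ℚ := fun k => ∏ i ∈ Finset.range m, centralWeight (n (i + 2)) k with hQ
  have hL : chainMoment r (m + 1) n = ∑ k ∈ Finset.Icc 1 (n 0), 2 * P * (k : ℚ) ^ (2 * r + 1) * Q k *
      (((n 0 - 1).factorial : ℚ) * (n 0 + n 1).factorial * (n 1 + n 2).factorial *
        (centralWeight (n 0) k * centralWeight (n 1) k)) := by
    simp only [chainMoment, Finset.prod_range_succ' _ (m + 1), Finset.prod_range_succ' _ m,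
      Finset.mul_sum]
    refine Finset.sum_congr rfl fun k _ => ?_
    simp only [hP, hQ, add_assoc, Nat.reduceAdd, zero_add]
    ring
  have hR (s : ℕ) (hs : s ∈ Finset.Icc 1 (n 0)) : chainMoment r m (mergeHead s n) =
      ∑ k ∈ Finset.Icc 1 (n 0), 2 * P * (k : ℚ) ^ (2 * r + 1) * Q k *
        ((s - 1).factorial * (s + n 2).factorial * centralWeight s k) := by
    have hI : Finset.Icc 1 s ⊆ Finset.Icc 1 (n 0) :=
      Finset.Icc_subset_Icc_right (Finset.mem_Icc.1 hs).2
    rw [← Finset.sum_subset hI]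
    · simp only [chainMoment, Finset.prod_range_succ' _ m, mergeHead, Finset.mul_sum]
      refine Finset.sum_congr rfl fun k _ => ?_
      simp only [hP, hQ, add_assoc, Nat.reduceAdd, zero_add]
      ring
    · intro k hk hk'
      rw [centralWeight_eq_zero, mul_zero, mul_zero]
      simp only [Finset.mem_Icc] at hk hk'
      omega
  refine hL.trans (Eq.trans ?_ (Finset.sum_congr rfl fun s hs => by rw [hR s hs]).symm)
  simp only [Finset.mul_sum]
  rw [Finset.sum_comm]
  refine Finset.sum_congr rfl fun k hk => ?_
  rw [centralWeight_mul _ _ _ _ (Finset.mem_Icc.1 hk).1, Finset.mul_sum]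
  exact Finset.sum_congr rfl fun s _ => by ring

theorem chainMoment_isInt (r m : ℕ) (n : ℕ → ℕ) (h0 : 0 < n 0) (hlast : n (m + 1) = 0) :
    ∃ z : ℤ, chainMoment r m n = z := by
  induction m generalizing n with
  | zero =>
    obtain ⟨z, hz⟩ := centralMoment_isInt r (n 0 - 1)
    refine ⟨z, ?_⟩
    rw [Nat.sub_add_cancel h0] at hz
    rw [zero_add] at hlast
    simpa [chainMoment, centralMoment, hlast] using hz
  | succ m ih =>
    rw [chainMoment_succ]
    have h (s : ℕ) : ∃ z : ℤ, s ∈ Finset.Icc 1 (n 0) → chainMoment r m (mergeHead s n) = z := by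
      by_cases hs : s ∈ Finset.Icc 1 (n 0)
      -- Only the head must be positive, and s ≥ 1 ensures this; the final zero survives merging.
      · obtain ⟨z, hz⟩ := ih (mergeHead s n) (Finset.mem_Icc.1 hs).1 hlast
        exact ⟨z, fun _ => hz⟩
      · exact ⟨0, fun h => absurd h hs⟩
    choose f hf using h
    refine ⟨∑ s ∈ Finset.Icc 1 (n 0),
      ((n 0 - 1).choose (s - 1) : ℤ) * ((n 1 + n 2).choose (n 2 + s) : ℤ) * f s, ?_⟩
    push_cast
    exact Finset.sum_congr rfl fun s hs => by rw [hf s hs]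

theorem prod_Icc_one_eq_prod_range (m : ℕ) (f : ℕ → ℚ) :
    ∏ i ∈ Finset.Icc 1 m, f i = ∏ i ∈ Finset.range m, f (i + 1) := by
  rw [← Finset.Ico_add_one_right_eq_Icc, Finset.prod_Ico_eq_prod_range]
  simp [add_comm]

theorem theorem6p4 (m : ℕ) (hm : 1 ≤ m) (n : ℕ → ℕ)
    (hpos : ∀ i ∈ Finset.Icc 1 m, 0 < n i) (hlast : n (m + 1) = 0) (r : ℕ) :
    ∃ z : ℤ,
      2 * (Nat.factorial (n 1 - 1) : ℚ) *
          (∏ i ∈ Finset.Icc 1 m,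
            (Nat.factorial (n i + n (i + 1)) : ℚ) / (Nat.factorial (2 * n i) : ℚ)) *
          (∑ k ∈ Finset.Icc 1 (n 1),
            (k : ℚ) ^ (2 * r + 1) *
              ∏ i ∈ Finset.Icc 1 m, (Nat.choose (2 * n i) (n i + k) : ℚ)) =
        (z : ℚ) := by
  obtain ⟨m, rfl⟩ := Nat.exists_eq_add_of_le' hm
  obtain ⟨z, hz⟩ := chainMoment_isInt r m (fun i => n (i + 1))
    (hpos 1 (Finset.mem_Icc.2 ⟨le_rfl, hm⟩)) hlast
  refine ⟨z, ?_⟩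
  rw [← hz]
  simp only [chainMoment, centralWeight, prod_Icc_one_eq_prod_range, Finset.prod_div_distrib,
    Finset.mul_sum, zero_add]
  exact Finset.sum_congr rfl fun k _ => by ring
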